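/- Let $M$ be a matroid on a finite ground set $[n]=\{1,\dots,n\}$ with set of bases $\mathcal{B}_M$, and let $$g_M(z_1,\dots,z_n)=\sum_{B\in\mathcal{B}_M}\ \prod_{i\in B} z_i\ \in\ \mathbb{R}[z_1,\dots,z_n]$$ be its basis generating polynomial. Then $g_M$ is completely log-concave on the positive orthant. That is, for every integer $k\ge 0$ and every matrix $V=(V_{ij})\in\mathbb{R}_{\ge 0}^{n\times k}$ with nonnegative entries, the polynomial $$D_V g_M=\Bigl(\prod_{j=1}^{k}\ \sum_{i=1}^{n}V_{ij}\,\partial_{z_i}\Bigr)g_M$$ is nonnegative on $\mathbb{R}_{>0}^n$, and it is log-concave there: either $D_V g_M$ is the zero polynomial, or it is positive on $\mathbb{R}_{>0}^n$ and $\log (D_V g_M)$ is a concave function on $\mathbb{R}_{>0}^n$. -/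

import Mathlib

/-- The basis generating polynomial `g_M = ∑_B ∏_{i ∈ B} z_i`, the sum being over all bases `B`
of the matroid `M`, in variables indexed by the elements. -/
noncomputable def Matroid.basisGenPoly {α : Type*} [Fintype α] (M : Matroid α) :
    MvPolynomial α ℝ :=
  open Classical in
  ∑ B : Finset α with M.IsBase (B : Set α), ∏ i ∈ B, MvPolynomial.X i

/-- The differential operator `∂_v = ∑ i, v i ∂_i` on polynomials. -/
noncomputable def MvPolynomial.dirDeriv {σ : Type*} [Fintype σ] (v : σ → ℝ) :
    Module.End ℝ (MvPolynomial σ ℝ) :=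
  ∑ i, v i • (MvPolynomial.pderiv i).toLinearMap

/-- The differential operator `D_V = ∏_{j=1}^k ∑_i V i j ∂_i`, the composition of the operators
`∂_v` with `v` ranging over the columns of the matrix `V` (these operators commute). -/
noncomputable def MvPolynomial.matrixDeriv {σ : Type*} [Fintype σ] {k : ℕ}
    (V : Matrix σ (Fin k) ℝ) : Module.End ℝ (MvPolynomial σ ℝ) :=
  (List.ofFn fun j : Fin k => MvPolynomial.dirDeriv fun i => V i j).prod

/-- The open positive orthant. -/
def positiveOrthant (σ : Type*) : Set (σ → ℝ) :=
  {z | ∀ i, 0 < z i}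

/-- A polynomial is log-concave on the positive orthant if it is zero, or if it is positive there
and its logarithm is a concave function there. The positivity makes the logarithm meaningful; it
is automatic for nonzero polynomials with nonnegative coefficients. -/
def MvPolynomial.IsLogConcave {σ : Type*} (g : MvPolynomial σ ℝ) : Prop :=
  g = 0 ∨ ((∀ z ∈ positiveOrthant σ, 0 < MvPolynomial.eval z g) ∧
    ConcaveOn ℝ (positiveOrthant σ) fun z => Real.log (MvPolynomial.eval z g))

/-- A polynomial `g` is completely log-concave if for all `k ≥ 0` and all matrices `V` with `k`
columns and nonnegative entries, `D_V g` is nonnegative and log-concave on the positive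
orthant. -/
def MvPolynomial.IsCompletelyLogConcave {σ : Type*} [Fintype σ] (g : MvPolynomial σ ℝ) : Prop :=
  ∀ (k : ℕ) (V : Matrix σ (Fin k) ℝ), (∀ i j, 0 ≤ V i j) →
    (∀ z ∈ positiveOrthant σ, 0 ≤ MvPolynomial.eval z (MvPolynomial.matrixDeriv V g)) ∧
      (MvPolynomial.matrixDeriv V g).IsLogConcave

/-! Differentiating `g_M` along a nonloop `i` contracts it: the derivative is the basis polynomial
of `M ／ {i}`; along a loop it is zero. So mixed derivatives of full order obey a recursion on rank
(`mixedDeriv_cons`), and the theorem reduces to an Alexandrov–Fenchel inequality for them,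
`mixedDeriv_mul_le_sq`.

That inequality says that the form `H` of `(x, y) ↦ D_x D_y D_L g_M` has at most one positive
direction. In rank two `H` is all-ones on nonloops minus a block for each parallel class. In higher
rank, with `v` the next direction, the inequality for the contractions bounds the form of `H` by `∑
i, v i * (H y) i ^ 2 / (H v) i`. After rescaling `H`, this forces each positive eigenvalue `c` to
satisfy `c ≤ c ^ 2`. Since `H` is nonnegative and connected, a Perron–Frobenius argument shows that
1 is the top eigenvalue and is simple (`dotProduct_mulVec_nonpos_of_le_sum`).

Filling the remaining slots with copies of the point `z` turns mixed derivatives into values at `z`,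
by Euler's identity, and yields the Hessian criterion for log-concavity. -/

namespace MvPolynomial

/-! ### Calculus of iterated directional derivatives. -/

section DirDeriv

variable {σ : Type*}

theorem pderiv_comm (i j : σ) (f : MvPolynomial σ ℝ) :
    pderiv i (pderiv j f) = pderiv j (pderiv i f) := by
  classical
  ext m
  simp only [coeff_pderiv, Finsupp.add_apply, Finsupp.single_apply]
  rw [add_right_comm]
  by_cases h : i = j
  · simp [h]
  · simp [h, Ne.symm h]; ring

theorem convex_positiveOrthant : Convex ℝ (positiveOrthant σ) := by
  intro x hx y hy a b ha hb hab i
  have hx := hx i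
  have hy := hy i
  simp only [Pi.add_apply, Pi.smul_apply, smul_eq_mul]
  rcases ha.eq_or_lt with rfl | ha
  · simp only [zero_add] at hab; subst hab; simpa
  · have := mul_pos ha hx
    have := mul_nonneg hb hy.le
    linarith

theorem eval_nonneg_of_coeff_nonneg {f : MvPolynomial σ ℝ} (hf : ∀ m, 0 ≤ coeff m f)
    {z : σ → ℝ} (hz : ∀ i, 0 ≤ z i) : 0 ≤ eval z f := by
  rw [eval_eq]
  exact Finset.sum_nonneg fun m _ =>
    mul_nonneg (hf m) (Finset.prod_nonneg fun i _ => pow_nonneg (hz i) _)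

theorem eval_pos_of_coeff_nonneg {f : MvPolynomial σ ℝ} (hf : ∀ m, 0 ≤ coeff m f) (h0 : f ≠ 0)
    {z : σ → ℝ} (hz : z ∈ positiveOrthant σ) : 0 < eval z f := by
  rw [eval_eq]
  refine Finset.sum_pos (fun m hm => ?_) (support_nonempty.mpr h0)
  exact mul_pos ((hf m).lt_of_ne' (mem_support_iff.mp hm))
    (Finset.prod_pos fun i _ => pow_pos (hz i) _)

variable [Fintype σ]

theorem dirDeriv_apply (v : σ → ℝ) (f : MvPolynomial σ ℝ) :
    dirDeriv v f = ∑ i, v i • pderiv i f := by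
  simp [dirDeriv, LinearMap.sum_apply]

theorem dirDeriv_pderiv (v : σ → ℝ) (i : σ) (f : MvPolynomial σ ℝ) :
    dirDeriv v (pderiv i f) = pderiv i (dirDeriv v f) := by
  simp only [dirDeriv_apply, map_sum, Derivation.map_smul, pderiv_comm]

theorem dirDeriv_comm (v w : σ → ℝ) (f : MvPolynomial σ ℝ) :
    dirDeriv v (dirDeriv w f) = dirDeriv w (dirDeriv v f) := by
  rw [dirDeriv_apply w, map_sum, dirDeriv_apply w]
  simp only [map_smul, dirDeriv_pderiv]

theorem dirDeriv_add (v w : σ → ℝ) : dirDeriv (v + w) = dirDeriv v + dirDeriv w := by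
  simp [dirDeriv, add_smul, Finset.sum_add_distrib]

theorem dirDeriv_smul (c : ℝ) (v : σ → ℝ) : dirDeriv (c • v) = c • dirDeriv v := by
  simp [dirDeriv, Finset.smul_sum, smul_smul]

theorem dirDeriv_single [DecidableEq σ] (i : σ) (f : MvPolynomial σ ℝ) :
    dirDeriv (Pi.single i 1) f = pderiv i f := by
  rw [dirDeriv_apply, Finset.sum_eq_single i] <;> simp +contextual

/-- The composition of the directional derivatives along the vectors of a list. -/
noncomputable def listDeriv (L : List (σ → ℝ)) : Module.End ℝ (MvPolynomial σ ℝ) :=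
  (L.map dirDeriv).prod

@[simp]
theorem listDeriv_nil (f : MvPolynomial σ ℝ) : listDeriv [] f = f := rfl

theorem listDeriv_cons (v : σ → ℝ) (L : List (σ → ℝ)) (f : MvPolynomial σ ℝ) :
    listDeriv (v :: L) f = dirDeriv v (listDeriv L f) := by
  simp [listDeriv]

theorem dirDeriv_listDeriv (v : σ → ℝ) (L : List (σ → ℝ)) (f : MvPolynomial σ ℝ) :
    dirDeriv v (listDeriv L f) = listDeriv L (dirDeriv v f) := by
  induction L with
  | nil => rfl
  | cons w L ih => rw [listDeriv_cons, listDeriv_cons, dirDeriv_comm, ih]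

theorem listDeriv_append (L L' : List (σ → ℝ)) (f : MvPolynomial σ ℝ) :
    listDeriv (L ++ L') f = listDeriv L (listDeriv L' f) := by
  simp [listDeriv]

theorem matrixDeriv_eq_listDeriv {k : ℕ} (V : Matrix σ (Fin k) ℝ) :
    matrixDeriv V = listDeriv (List.ofFn fun j i => V i j) := by
  simp [matrixDeriv, listDeriv, List.map_ofFn, Function.comp_def]

theorem IsHomogeneous.dirDeriv {f : MvPolynomial σ ℝ} {d : ℕ} (hf : f.IsHomogeneous d)
    (v : σ → ℝ) : (MvPolynomial.dirDeriv v f).IsHomogeneous (d - 1) := by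
  rw [dirDeriv_apply]
  refine IsHomogeneous.sum _ _ _ fun i _ => ?_
  rw [smul_eq_C_mul]
  simpa using (isHomogeneous_C σ (v i)).mul hf.pderiv

theorem dirDeriv_eq_zero_of_isHomogeneous_zero {f : MvPolynomial σ ℝ} (hf : f.IsHomogeneous 0)
    (v : σ → ℝ) : MvPolynomial.dirDeriv v f = 0 := by
  rw [← totalDegree_zero_iff_isHomogeneous, totalDegree_eq_zero_iff_eq_C] at hf
  rw [hf, dirDeriv_apply]
  simp

theorem IsHomogeneous.listDeriv {f : MvPolynomial σ ℝ} {d : ℕ} (hf : f.IsHomogeneous d)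
    (L : List (σ → ℝ)) : (MvPolynomial.listDeriv L f).IsHomogeneous (d - L.length) := by
  induction L with
  | nil => simpa
  | cons v L ih => rw [listDeriv_cons, List.length_cons, ← Nat.sub_sub]; exact ih.dirDeriv v

theorem listDeriv_eq_zero_of_lt {f : MvPolynomial σ ℝ} {d : ℕ} (hf : f.IsHomogeneous d)
    (L : List (σ → ℝ)) (hd : d < L.length) : MvPolynomial.listDeriv L f = 0 := by
  cases L with
  | nil => simp at hd
  | cons v L =>
    rw [listDeriv_cons]
    -- The tail alone already brings the degree down to zero, possibly through truncated
    -- subtraction.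
    refine dirDeriv_eq_zero_of_isHomogeneous_zero ?_ v
    have h := hf.listDeriv L
    rwa [Nat.sub_eq_zero_of_le (by simpa [Nat.lt_succ_iff] using hd)] at h

/-- Euler's identity for the directional derivative at a point in the direction of that point. -/
theorem IsHomogeneous.eval_dirDeriv_self {f : MvPolynomial σ ℝ} {d : ℕ} (hf : f.IsHomogeneous d)
    (z : σ → ℝ) : eval z (MvPolynomial.dirDeriv z f) = d * eval z f := by
  have h := congrArg (eval z) hf.sum_X_mul_pderiv
  simpa [dirDeriv_apply, smul_eval] using h

/-- Iterated Euler identity. The full-order derivative is a constant, so evaluating it at the origin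
loses nothing. -/
theorem IsHomogeneous.eval_listDeriv_replicate {f : MvPolynomial σ ℝ} {d : ℕ}
    (hf : f.IsHomogeneous d) (z : σ → ℝ) :
    eval 0 (MvPolynomial.listDeriv (List.replicate d z) f) = d.factorial * eval z f := by
  induction d generalizing f with
  | zero =>
    rw [← totalDegree_zero_iff_isHomogeneous, totalDegree_eq_zero_iff_eq_C] at hf
    rw [hf]; simp
  | succ d ih =>
    rw [List.replicate_succ, listDeriv_cons, dirDeriv_listDeriv, ih (by simpa using hf.dirDeriv z),
      hf.eval_dirDeriv_self, Nat.factorial_succ]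
    push_cast; ring

theorem hasDerivAt_eval_line (f : MvPolynomial σ ℝ) (z x : σ → ℝ) (t : ℝ) :
    HasDerivAt (fun t : ℝ => eval (z + t • x) f) (eval (z + t • x) (dirDeriv x f)) t := by
  classical
  induction f using MvPolynomial.induction_on with
  | C a => simpa [dirDeriv_apply] using hasDerivAt_const t a
  | add p q hp hq => simpa using hp.fun_add hq
  | mul_X p i hp =>
    have h1 : HasDerivAt (fun t : ℝ => (z + t • x) i) (x i) t := by
      simpa using ((hasDerivAt_id t).mul_const (x i)).const_add (z i)
    have h2 : dirDeriv x (p * X i) = dirDeriv x p * X i + p * C (x i) := by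
      simp only [dirDeriv_apply, pderiv_mul, smul_add, Finset.sum_add_distrib, pderiv_X,
        Finset.sum_mul, smul_mul_assoc]
      congr 1
      rw [Finset.sum_eq_single i] <;> simp +contextual [smul_eq_C_mul, mul_comm]
    simpa [h2] using hp.fun_mul h1

theorem dirDeriv_coeff_nonneg {f : MvPolynomial σ ℝ} (hf : ∀ m, 0 ≤ coeff m f) {v : σ → ℝ}
    (hv : ∀ i, 0 ≤ v i) (m : σ →₀ ℕ) : 0 ≤ coeff m (dirDeriv v f) := by
  rw [dirDeriv_apply, coeff_sum]
  refine Finset.sum_nonneg fun i _ => ?_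
  rw [coeff_smul, coeff_pderiv]
  exact mul_nonneg (hv i) (mul_nonneg (hf _) (by positivity))

theorem listDeriv_coeff_nonneg {f : MvPolynomial σ ℝ} (hf : ∀ m, 0 ≤ coeff m f)
    {L : List (σ → ℝ)} (hL : ∀ v ∈ L, ∀ i, 0 ≤ v i) (m : σ →₀ ℕ) :
    0 ≤ coeff m (listDeriv L f) := by
  induction L generalizing m with
  | nil => exact hf m
  | cons v L ih =>
    rw [listDeriv_cons]
    simp only [List.mem_cons, forall_eq_or_imp] at hL
    exact dirDeriv_coeff_nonneg (ih hL.2) hL.1 m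

/-- Multilinearity makes the value a polynomial in `ε`. This serves to pass from positive to
nonnegative directions. -/
theorem continuous_eval_listDeriv_perturb (u : σ → ℝ) (L : List (σ → ℝ))
    (f : MvPolynomial σ ℝ) :
    Continuous fun ε : ℝ => eval 0 (listDeriv (L.map fun v => v + ε • u) f) := by
  induction L generalizing f with
  | nil => simpa using continuous_const
  | cons v L ih =>
    have h : ∀ ε : ℝ, eval 0 (listDeriv ((v :: L).map fun v => v + ε • u) f) =
        eval 0 (listDeriv (L.map fun v => v + ε • u) (dirDeriv v f)) +
          ε * eval 0 (listDeriv (L.map fun v => v + ε • u) (dirDeriv u f)) := fun ε => by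
      rw [List.map_cons, listDeriv_cons, dirDeriv_listDeriv, dirDeriv_add, dirDeriv_smul]
      simp
    simp only [h]
    exact (ih _).add (continuous_id.mul (ih _))

end DirDeriv

/-! ### From a Hessian inequality to concavity of the logarithm. -/

section LogConcave

variable {σ : Type*} [Fintype σ]

/-- The second-order criterion for log-concavity on the positive orthant. -/
theorem concaveOn_log_eval {f : MvPolynomial σ ℝ}
    (hpos : ∀ z ∈ positiveOrthant σ, 0 < eval z f)
    (h : ∀ z ∈ positiveOrthant σ, ∀ x,
      eval z f * eval z (dirDeriv x (dirDeriv x f)) ≤ eval z (dirDeriv x f) ^ 2) :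
    ConcaveOn ℝ (positiveOrthant σ) fun z => Real.log (eval z f) := by
  refine ⟨convex_positiveOrthant, ?_⟩
  intro z hz y hy a b ha hb hab
  set x := y - z with hx
  have hmem : ∀ t ∈ Set.Icc (0 : ℝ) 1, z + t • x ∈ positiveOrthant σ := fun t ht => by
    have := convex_positiveOrthant hz hy (sub_nonneg.2 ht.2) ht.1 (by ring)
    convert this using 1
    rw [hx]; module
  set p : ℝ → ℝ := fun t => eval (z + t • x) f with hp
  set p' : ℝ → ℝ := fun t => eval (z + t • x) (dirDeriv x f) with hp'
  set p'' : ℝ → ℝ := fun t => eval (z + t • x) (dirDeriv x (dirDeriv x f)) with hp''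
  have d1 : ∀ t, HasDerivAt p (p' t) t := fun t => hasDerivAt_eval_line f z x t
  have d2 : ∀ t, HasDerivAt p' (p'' t) t := fun t => hasDerivAt_eval_line _ z x t
  have hpp : ∀ t ∈ Set.Icc (0 : ℝ) 1, 0 < p t := fun t ht => hpos _ (hmem t ht)
  have key : ConcaveOn ℝ (Set.Icc (0 : ℝ) 1) fun t => Real.log (p t) := by
    refine concaveOn_of_hasDerivWithinAt2_nonpos (f' := fun t => p' t / p t)
      (f'' := fun t => (p'' t * p t - p' t * p' t) / p t ^ 2) (convex_Icc 0 1) ?_ ?_ ?_ ?_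
    · intro t ht
      exact ((d1 t).log (hpp t ht).ne').continuousAt.continuousWithinAt
    · intro t ht
      exact ((d1 t).log (hpp t (interior_subset ht)).ne').hasDerivWithinAt
    · intro t ht
      exact ((d2 t).div (d1 t) (hpp t (interior_subset ht)).ne').hasDerivWithinAt
    · intro t ht
      have := h _ (hmem t (interior_subset ht)) x
      refine div_nonpos_of_nonpos_of_nonneg ?_ (sq_nonneg _)
      simp only [hp, hp', hp'']
      nlinarith
  have := key.2 (Set.left_mem_Icc.2 zero_le_one) (Set.right_mem_Icc.2 zero_le_one) ha hb hab
  have e1 : p 0 = eval z f := by simp [hp]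
  have e2 : p 1 = eval y f := by simp [hp, hx]
  have e3 : p b = eval (a • z + b • y) f := by
    have : z + b • x = a • z + b • y := by
      rw [hx, eq_sub_of_add_eq hab]; module
    simp only [hp, this]
  simpa [e1, e2, e3] using this

end LogConcave

end MvPolynomial

/-! ### Symmetric forms with at most one positive direction. -/

namespace Matrix

variable {n : Type*} [Fintype n]

/-- A real symmetric form is nonpositive at every vector that is orthogonal to all eigenvectors
with positive eigenvalue. -/
theorem IsHermitian.dotProduct_mulVec_nonpos {B : Matrix n n ℝ} (hB : B.IsHermitian) (x : n → ℝ)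
    (h : ∀ (c : ℝ) (b : n → ℝ), 0 < c → B *ᵥ b = c • b → b ⬝ᵥ b = 1 → b ⬝ᵥ x = 0) :
    x ⬝ᵥ B *ᵥ x ≤ 0 := by
  classical
  have hx := hB.eigenvectorBasis.sum_inner_mul_inner (WithLp.toLp 2 x) (WithLp.toLp 2 (B *ᵥ x))
  simp only [EuclideanSpace.inner_eq_star_dotProduct, star_trivial] at hx
  rw [dotProduct_comm, ← hx]
  refine Finset.sum_nonpos fun i _ => ?_
  have hBi := hB.mulVec_eigenvectorBasis i
  have hsymm : B *ᵥ x ⬝ᵥ ⇑(hB.eigenvectorBasis i) =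
      hB.eigenvalues i * (hB.eigenvectorBasis i ⬝ᵥ x) := by
    rw [dotProduct_comm, dotProduct_mulVec, ← mulVec_transpose,
      show Bᵀ = B by simpa [IsHermitian] using hB, hBi, smul_dotProduct, smul_eq_mul]
  have hone : (hB.eigenvectorBasis i : n → ℝ) ⬝ᵥ hB.eigenvectorBasis i = 1 := by
    have := hB.eigenvectorBasis.orthonormal.1 i
    have h2 := real_inner_self_eq_norm_sq (hB.eigenvectorBasis i)
    rwa [this, one_pow, EuclideanSpace.inner_eq_star_dotProduct, star_trivial] at h2
  rw [hsymm]
  rcases le_or_gt (hB.eigenvalues i) 0 with h0 | h0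
  · nlinarith [mul_nonneg (neg_nonneg.2 h0) (sq_nonneg (hB.eigenvectorBasis i ⬝ᵥ x))]
  · rw [h _ _ h0 hBi hone]; simp

/-- Dirichlet energy of the ratio `y / w`. For nonnegative `H` and positive `w` it bounds the form
of `H` above, with equality only if the ratio is constant along edges of `H`. -/
theorem sum_mul_sq_sub_eq {H : Matrix n n ℝ} (hH : H.IsSymm) {w : n → ℝ} (hw : ∀ i, w i ≠ 0)
    (y : n → ℝ) :
    ∑ i, ∑ j, H i j * (w i * w j * (y i / w i - y j / w j) ^ 2) =
      2 * ∑ i, y i ^ 2 * ((H *ᵥ w) i / w i) - 2 * (y ⬝ᵥ H *ᵥ y) := by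
  have e : ∀ i j, H i j * (w i * w j * (y i / w i - y j / w j) ^ 2) =
      y i ^ 2 / w i * (H i j * w j) + y j ^ 2 / w j * (H j i * w i) -
        2 * (y i * (H i j * y j)) := fun i j => by
    rw [hH.apply i j]
    have := hw i
    have := hw j
    field_simp
    ring
  have e1 : ∑ i, ∑ j, y i ^ 2 / w i * (H i j * w j) = ∑ i, y i ^ 2 * ((H *ᵥ w) i / w i) := by
    refine Finset.sum_congr rfl fun i _ => ?_
    rw [← Finset.mul_sum, mulVec, dotProduct]
    ring
  have e2 : ∑ i, ∑ j, 2 * (y i * (H i j * y j)) = 2 * (y ⬝ᵥ H *ᵥ y) := by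
    simp only [dotProduct, mulVec, Finset.mul_sum]
  simp only [e, Finset.sum_sub_distrib, Finset.sum_add_distrib]
  rw [Finset.sum_comm (f := fun i j => y j ^ 2 / w j * (H j i * w i)), e1, e2]
  ring

/-- Let `H` be a nonnegative symmetric matrix, connected on the support of `H *ᵥ w`, whose form is
bounded by `∑ i, w i * (H *ᵥ y) i ^ 2 / (H *ᵥ w) i`. Then the form is nonpositive on the hyperplane
orthogonal to `H *ᵥ w`. -/
theorem dotProduct_mulVec_nonpos_of_le_sum {H : Matrix n n ℝ} (hH : H.IsSymm)
    (hpos : ∀ i j, 0 ≤ H i j) {w : n → ℝ} (hw : ∀ i, 0 < w i)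
    (hconn : ∀ i j, (H *ᵥ w) i ≠ 0 → (H *ᵥ w) j ≠ 0 →
      H i j ≠ 0 ∨ ∃ k, H i k ≠ 0 ∧ H k j ≠ 0)
    (hle : ∀ y : n → ℝ, y ⬝ᵥ H *ᵥ y ≤ ∑ i, w i * ((H *ᵥ y) i ^ 2 / (H *ᵥ w) i))
    {x : n → ℝ} (hx : H *ᵥ w ⬝ᵥ x = 0) : x ⬝ᵥ H *ᵥ x ≤ 0 := by
  classical
  set d := H *ᵥ w with hd
  have hterm : ∀ i j, 0 ≤ H i j * w j := fun i j => mul_nonneg (hpos i j) (hw j).le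
  have hd0 : ∀ i, 0 ≤ d i := fun i => Finset.sum_nonneg fun j _ => hterm i j
  have hHd : ∀ i j, d i = 0 → H i j = 0 := fun i j h => by
    have := (Finset.sum_eq_zero_iff_of_nonneg fun j _ => hterm i j).1 h j (Finset.mem_univ j)
    exact (mul_eq_zero.1 this).resolve_right (hw j).ne'
  set s : n → ℝ := fun i => √(d i / w i) with hs
  have hs2 : ∀ i, s i ^ 2 = d i / w i := fun i => Real.sq_sqrt (div_nonneg (hd0 i) (hw i).le)
  have hs0 : ∀ i, s i = 0 → d i = 0 := fun i h => by
    have := hs2 i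
    rw [h, zero_pow two_ne_zero, eq_comm, div_eq_zero_iff] at this
    exact this.resolve_right (hw i).ne'
  -- The rescaling gives `B` the eigenvector `s * w` with eigenvalue 1. Where `s i = 0` the inverse
  -- is 0 by convention, which is harmless because that row and column of `H` vanish.
  set B : Matrix n n ℝ := Matrix.of fun i j => (s i)⁻¹ * H i j * (s j)⁻¹ with hB
  have hHB : ∀ i j, H i j = s i * B i j * s j := fun i j => by
    by_cases hi : s i = 0
    · rw [hi, hHd i j (hs0 i hi)]; simp
    by_cases hj : s j = 0
    · rw [hj, ← hH.apply i j, hHd j i (hs0 j hj)]; simp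
    simp only [hB, Matrix.of_apply]
    field_simp
  have hBherm : B.IsHermitian := by
    ext i j
    simp only [hB, conjTranspose_apply, Matrix.of_apply, star_trivial, hH.apply i j]
    ring
  have hform : x ⬝ᵥ H *ᵥ x = (fun i => s i * x i) ⬝ᵥ B *ᵥ (fun i => s i * x i) := by
    simp only [dotProduct, mulVec, Finset.mul_sum]
    refine Finset.sum_congr rfl fun i _ => Finset.sum_congr rfl fun j _ => ?_
    rw [hHB i j]; ring
  rw [hform]
  refine hBherm.dotProduct_mulVec_nonpos _ fun c b hc hb hb1 => ?_
  have hbi : ∀ i, ∑ j, B i j * b j = c * b i := fun i => congrFun hb i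
  have hb0 : ∀ i, s i = 0 → b i = 0 := fun i hi => by
    have h0 : ∑ j, B i j * b j = 0 := Finset.sum_eq_zero fun j _ => by simp [hB, hi]
    rw [hbi i] at h0
    exact (mul_eq_zero.1 h0).resolve_left hc.ne'
  set y : n → ℝ := fun i => (s i)⁻¹ * b i with hy
  have hby : ∀ i, b i = s i * y i := fun i => by
    by_cases hi : s i = 0
    · rw [hi, hb0 i hi, zero_mul]
    · simp only [hy]; field_simp
  have hHy : ∀ i, (H *ᵥ y) i = s i * (c * b i) := fun i => by
    rw [← hbi i, Finset.mul_sum]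
    refine Finset.sum_congr rfl fun j _ => ?_
    change H i j * y j = _
    rw [hHB i j, hby j]; ring
  have hb1' : ∑ i, b i ^ 2 = 1 := by
    rw [← hb1]; exact Finset.sum_congr rfl fun i _ => sq (b i)
  have hyHy : y ⬝ᵥ H *ᵥ y = c := by
    rw [← mul_one c, ← hb1', Finset.mul_sum]
    refine Finset.sum_congr rfl fun i _ => ?_
    rw [hHy, hby i]; ring
  have hbound : ∑ i, w i * ((H *ᵥ y) i ^ 2 / d i) ≤ c ^ 2 := by
    rw [← mul_one (c ^ 2), ← hb1', Finset.mul_sum]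
    refine Finset.sum_le_sum fun i _ => ?_
    rw [hHy, mul_pow, hs2]
    have := (hw i).ne'
    rcases (hd0 i).eq_or_lt with h | h
    · rw [← h]; simp only [div_zero, mul_zero]; positivity
    · exact le_of_eq (by field_simp)
  -- The hypothesis `hle` at `y` reads `c ≤ c ^ 2`.
  have hc1 : 1 ≤ c := by
    have := (hle y).trans hbound
    rw [hyHy] at this
    nlinarith
  have hsum := sum_mul_sq_sub_eq hH (fun i => (hw i).ne') y
  have hsq : ∑ i, y i ^ 2 * (d i / w i) = 1 := by
    rw [← hb1']
    exact Finset.sum_congr rfl fun i _ => by rw [← hs2, hby i]; ring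
  rw [hyHy, ← hd, hsq] at hsum
  have hnn : ∀ i j, 0 ≤ H i j * (w i * w j * (y i / w i - y j / w j) ^ 2) := fun i j =>
    mul_nonneg (hpos i j) (mul_nonneg (mul_pos (hw i) (hw j)).le (sq_nonneg _))
  -- The energy equals `2 - 2 * c`, which is nonpositive because `1 ≤ c`; hence it vanishes and `y /
  -- w` is constant along edges.
  have hzero : ∑ i, ∑ j, H i j * (w i * w j * (y i / w i - y j / w j) ^ 2) = 0 :=
    le_antisymm (by rw [hsum]; linarith)
      (Finset.sum_nonneg fun i _ => Finset.sum_nonneg fun j _ => hnn i j)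
  have hedge : ∀ i j, H i j ≠ 0 → y i / w i = y j / w j := fun i j hij => by
    have h1 := (Finset.sum_eq_zero_iff_of_nonneg fun i _ => Finset.sum_nonneg fun j _ =>
      hnn i j).1 hzero i (Finset.mem_univ i)
    have h2 := (Finset.sum_eq_zero_iff_of_nonneg fun j _ => hnn i j).1 h1 j (Finset.mem_univ j)
    simpa [hij, (hw i).ne', (hw j).ne', sub_eq_zero] using h2
  have hconst : ∀ i j, d i ≠ 0 → d j ≠ 0 → y i / w i = y j / w j := fun i j hi hj => by
    rcases hconn i j hi hj with h | ⟨k, h1, h2⟩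
    · exact hedge i j h
    · exact (hedge i k h1).trans (hedge k j h2)
  have hdot : b ⬝ᵥ (fun i => s i * x i) = ∑ i, y i / w i * (d i * x i) :=
    Finset.sum_congr rfl fun i _ => by
      rw [hby i, show s i * y i * (s i * x i) = s i ^ 2 * (y i * x i) by ring, hs2]; ring
  rw [hdot]
  -- With `y / w` constant on the support of `d`, the vector `b` is proportional to `s * w`, so its
  -- pairing with `s * x` is a multiple of `d ⬝ᵥ x = 0`.
  by_cases hall : ∀ i, d i = 0
  · simp [hall]
  · push Not at hall
    obtain ⟨i₀, hi₀⟩ := hall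
    rw [Finset.sum_congr rfl (g := fun i => y i₀ / w i₀ * (d i * x i)), ← Finset.mul_sum]
    · rw [show ∑ i, d i * x i = 0 from hx, mul_zero]
    · intro i _
      by_cases hi : d i = 0
      · simp [hi]
      · rw [hconst i i₀ hi hi₀]

/-- A symmetric form that is nonpositive on a hyperplane satisfies the reverse Cauchy–Schwarz
inequality at any vector where it is positive. -/
theorem mul_le_sq_of_nonpos_on_hyperplane {H : Matrix n n ℝ} (hH : H.IsSymm) {l : n → ℝ}
    (hneg : ∀ x, l ⬝ᵥ x = 0 → x ⬝ᵥ H *ᵥ x ≤ 0) {z : n → ℝ} (hz : 0 < z ⬝ᵥ H *ᵥ z) (x : n → ℝ) :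
    (x ⬝ᵥ H *ᵥ x) * (z ⬝ᵥ H *ᵥ z) ≤ (x ⬝ᵥ H *ᵥ z) ^ 2 := by
  have hlz : l ⬝ᵥ z ≠ 0 := fun h => absurd (hneg z h) (not_le.2 hz)
  have hsymm : z ⬝ᵥ H *ᵥ x = x ⬝ᵥ H *ᵥ z := by
    rw [dotProduct_mulVec, ← mulVec_transpose, hH.eq, dotProduct_comm]
  -- This combination of `x` and `z` lies in the hyperplane.
  have h := hneg ((l ⬝ᵥ z) • x - (l ⬝ᵥ x) • z) (by
    simp only [dotProduct_sub, dotProduct_smul, smul_eq_mul]; ring)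
  simp only [mulVec_sub, mulVec_smul, dotProduct_sub, sub_dotProduct, smul_dotProduct,
    dotProduct_smul, smul_eq_mul, hsymm] at h
  by_contra! hlt
  have h2 := sq_nonneg ((l ⬝ᵥ x) * (z ⬝ᵥ H *ᵥ z) - (l ⬝ᵥ z) * (x ⬝ᵥ H *ᵥ z))
  have h3 : 0 < (l ⬝ᵥ z) ^ 2 := by positivity
  nlinarith [mul_pos h3 (sub_pos.2 hlt), mul_nonpos_of_nonneg_of_nonpos hz.le h]

end Matrix

/-! ### Contraction, basis polynomials and their mixed derivatives. -/

namespace Matroid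

open MvPolynomial

variable {α : Type*}

theorem IsNonloop.eRank_contract_singleton {M : Matroid α} {i : α} (hi : M.IsNonloop i) :
    (M ／ {i}).eRank + 1 = M.eRank := by
  obtain ⟨B, hB⟩ := (M ／ {i}).exists_isBase
  have h := (hi.indep.contract_isBase_iff).1 hB
  rw [← hB.encard_eq_eRank, ← h.1.encard_eq_eRank, Set.encard_union_eq h.2, Set.encard_singleton]

theorem IsNonloop.eRank_contract_singleton_eq {M : Matroid α} {i : α} (hi : M.IsNonloop i)
    {d : ℕ} (hd : M.eRank = (d + 1 : ℕ)) : (M ／ {i}).eRank = d := by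
  have h := hi.eRank_contract_singleton
  rw [hd, Nat.cast_add_one] at h
  exact ENat.add_left_injective_of_ne_top ENat.one_ne_top h

/-- Otherwise a base would lie in the closure of `{i}`, whose rank is at most one. -/
theorem exists_isNonloop_closure_ne {M : Matroid α} {d : ℕ} (hd : M.eRank = (d + 2 : ℕ)) (i : α) :
    ∃ k, M.IsNonloop k ∧ M.closure {k} ≠ M.closure {i} := by
  obtain ⟨B, hB⟩ := M.exists_isBase
  by_contra! h
  have hsub : B ⊆ M.closure {i} := fun k hk => by
    rw [← h k (hB.indep.isNonloop_of_mem hk)]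
    exact M.mem_closure_self k (hB.subset_ground hk)
  have h1 : B.encard ≤ 1 := by
    calc B.encard ≤ M.eRk (M.closure {i}) := hB.indep.encard_le_eRk_of_subset hsub
      _ = M.eRk {i} := M.eRk_closure_eq _
      _ ≤ 1 := (M.eRk_le_encard {i}).trans (by simp)
  rw [hB.encard_eq_eRank, hd] at h1
  have : d + 2 ≤ 1 := by exact_mod_cast h1
  omega

theorem contract_singleton_isNonloop_iff {M : Matroid α} {i j : α} :
    (M ／ {i}).IsNonloop j ↔ M.IsNonloop j ∧ M.closure {i} ≠ M.closure {j} := by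
  refine ⟨fun h => ⟨h.of_contract, fun he => ?_⟩, fun ⟨hj, hne⟩ => ?_⟩
  · rw [contract_isNonloop_iff, he] at h
    exact h.2 (M.mem_closure_self j h.1)
  · rw [contract_isNonloop_iff]
    exact ⟨hj.mem_ground, fun h => hne (hj.closure_eq_of_mem_closure h).symm⟩

theorem pderiv_prod_X_of_notMem {i : α} {B : Finset α} (hi : i ∉ B) :
    pderiv i (∏ j ∈ B, (X j : MvPolynomial α ℝ)) = 0 := by
  classical
  induction B using Finset.induction_on with
  | empty => simp
  | insert a B ha ih =>
    rw [Finset.mem_insert, not_or] at hi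
    rw [Finset.prod_insert ha, pderiv_mul, ih hi.2, pderiv_X_of_ne (Ne.symm hi.1)]
    simp

theorem pderiv_prod_X_of_mem [DecidableEq α] {i : α} {B : Finset α} (hi : i ∈ B) :
    pderiv i (∏ j ∈ B, (X j : MvPolynomial α ℝ)) = ∏ j ∈ B.erase i, X j := by
  rw [← Finset.mul_prod_erase B _ hi, pderiv_mul, pderiv_X_self, one_mul,
    pderiv_prod_X_of_notMem (Finset.notMem_erase i B), mul_zero, add_zero]

variable [Fintype α]

open Classical in
theorem basisGenPoly_eq_sum (M : Matroid α) :
    M.basisGenPoly = ∑ B ∈ Finset.univ.filter (fun B : Finset α => M.IsBase (B : Set α)),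
      ∏ i ∈ B, (X i : MvPolynomial α ℝ) := by
  unfold basisGenPoly
  symm
  refine Finset.sum_bij (fun B _ => (B : Set α)) ?_ ?_ ?_ ?_
  · intro B hB
    simpa using hB
  · intro B _ B' _ h
    exact_mod_cast h
  · intro B hB
    refine ⟨B.toFinset, ?_, by simp⟩
    simpa using (Finset.mem_filter.1 hB).2
  · intro B _
    simp

theorem pderiv_basisGenPoly_of_not_isNonloop {M : Matroid α} {i : α} (hi : ¬ M.IsNonloop i) :
    pderiv i M.basisGenPoly = 0 := by
  classical
  simp only [basisGenPoly_eq_sum]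
  rw [map_sum]
  refine Finset.sum_eq_zero fun B hB => pderiv_prod_X_of_notMem fun hiB => hi ?_
  exact (Finset.mem_filter.1 hB).2.indep.isNonloop_of_mem (Finset.mem_coe.2 hiB)

theorem pderiv_basisGenPoly_of_isNonloop {M : Matroid α} {i : α} (hi : M.IsNonloop i) :
    pderiv i M.basisGenPoly = (M ／ {i}).basisGenPoly := by
  classical
  simp only [basisGenPoly_eq_sum]
  rw [map_sum, ← Finset.sum_filter_add_sum_filter_not _ (fun B => i ∈ B)]
  rw [Finset.sum_eq_zero (s := Finset.filter (fun B => i ∉ B) _) fun B hB =>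
    pderiv_prod_X_of_notMem (Finset.mem_filter.1 hB).2, add_zero,
    Finset.sum_congr rfl fun B hB => pderiv_prod_X_of_mem (Finset.mem_filter.1 hB).2]
  refine Finset.sum_nbij' (fun B => B.erase i) (fun B => insert i B) ?_ ?_ ?_ ?_ fun _ _ => rfl
  · intro B hB
    simp only [Finset.mem_filter, Finset.mem_univ, true_and] at hB ⊢
    rw [hi.indep.contract_isBase_iff]
    simpa [Set.insert_eq_of_mem (Finset.mem_coe.2 hB.2)] using hB.1
  · intro B hB
    simp only [Finset.mem_filter, Finset.mem_univ, true_and] at hB ⊢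
    rw [hi.indep.contract_isBase_iff] at hB
    simpa using hB.1
  · intro B hB
    exact Finset.insert_erase (Finset.mem_filter.1 hB).2
  · intro B hB
    simp only [Finset.mem_filter, Finset.mem_univ, true_and] at hB
    rw [hi.indep.contract_isBase_iff] at hB
    exact Finset.erase_insert (by simpa using hB.2)

theorem isHomogeneous_basisGenPoly {M : Matroid α} {d : ℕ} (hd : M.eRank = d) :
    M.basisGenPoly.IsHomogeneous d := by
  classical
  rw [basisGenPoly_eq_sum]
  refine IsHomogeneous.sum _ _ _ fun B hB => ?_
  have hc : B.card = d := by
    have h := (Finset.mem_filter.1 hB).2.encard_eq_eRank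
    rw [hd, Set.encard_coe_eq_coe_finsetCard] at h
    exact_mod_cast h
  simpa [hc] using IsHomogeneous.prod B (fun i => (X i : MvPolynomial α ℝ)) (fun _ => 1)
    fun i _ => isHomogeneous_X ℝ i

theorem coeff_basisGenPoly_nonneg (M : Matroid α) (m : α →₀ ℕ) :
    0 ≤ coeff m M.basisGenPoly := by
  classical
  simp only [basisGenPoly_eq_sum]
  rw [coeff_sum]
  refine Finset.sum_nonneg fun B _ => ?_
  have : ∏ i ∈ B, (X i : MvPolynomial α ℝ) = monomial (∑ i ∈ B, Finsupp.single i 1) 1 := by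
    rw [monomial_sum_one]; rfl
  rw [this, coeff_monomial]
  split_ifs <;> simp

theorem basisGenPoly_of_eRank_zero {M : Matroid α} (hd : M.eRank = 0) : M.basisGenPoly = 1 := by
  classical
  simp only [basisGenPoly_eq_sum]
  rw [Finset.sum_eq_single ∅]
  · simp
  · intro B hB hne
    have h := (Finset.mem_filter.1 hB).2.encard_eq_eRank
    rw [hd] at h
    simp at h
    exact absurd h hne
  · intro h
    obtain ⟨B, hB⟩ := M.exists_isBase
    have h0 := hB.encard_eq_eRank
    rw [hd, Set.encard_eq_zero] at h0
    subst h0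
    simp [hB] at h

/-- The value of `D_L g_M` at the origin, where `L` is a list of vectors; it is the mixed
derivative of `g_M` if the length of `L` is the rank of `M`. -/
noncomputable def mixedDeriv (M : Matroid α) (L : List (α → ℝ)) : ℝ :=
  eval 0 (listDeriv L M.basisGenPoly)

theorem mixedDeriv_nonneg (M : Matroid α) {L : List (α → ℝ)} (hL : ∀ v ∈ L, ∀ i, 0 ≤ v i) :
    0 ≤ M.mixedDeriv L :=
  eval_nonneg_of_coeff_nonneg (listDeriv_coeff_nonneg M.coeff_basisGenPoly_nonneg hL) fun _ => le_rfl

open Classical in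
theorem mixedDeriv_cons (M : Matroid α) (v : α → ℝ) (L : List (α → ℝ)) :
    M.mixedDeriv (v :: L) =
      ∑ i, v i * if M.IsNonloop i then (M ／ {i}).mixedDeriv L else 0 := by
  unfold mixedDeriv
  rw [listDeriv_cons, dirDeriv_listDeriv, dirDeriv_apply, map_sum, map_sum]
  refine Finset.sum_congr rfl fun i _ => ?_
  split_ifs with h
  · rw [pderiv_basisGenPoly_of_isNonloop h, map_smul, smul_eval]
  · rw [pderiv_basisGenPoly_of_not_isNonloop h]; simp

/-- Each nonloop contributes a positive term by induction on rank, and positive rank provides a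
nonloop. -/
theorem mixedDeriv_pos {M : Matroid α} {L : List (α → ℝ)} (hL : ∀ v ∈ L, ∀ i, 0 < v i)
    (hd : M.eRank = L.length) : 0 < M.mixedDeriv L := by
  classical
  induction L generalizing M with
  | nil =>
    rw [List.length_nil, Nat.cast_zero] at hd
    simp [mixedDeriv, basisGenPoly_of_eRank_zero hd]
  | cons v L ih =>
    simp only [List.mem_cons, forall_eq_or_imp] at hL
    rw [mixedDeriv_cons]
    have hterm : ∀ i, M.IsNonloop i → 0 < (M ／ {i}).mixedDeriv L := fun i hi =>
      ih hL.2 (hi.eRank_contract_singleton_eq hd)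
    have : M.RankPos := by
      rw [rankPos_iff]
      intro h
      have := h.encard_eq_eRank
      rw [hd] at this
      rw [Set.encard_empty, List.length_cons, Nat.cast_add_one] at this
      exact absurd this.symm (by simp)
    obtain ⟨i, hi⟩ := M.exists_isNonloop
    refine Finset.sum_pos' (fun j _ => mul_nonneg (hL.1 j).le ?_) ⟨i, Finset.mem_univ i, ?_⟩
    · split_ifs with h
      exacts [(hterm j h).le, le_rfl]
    · rw [if_pos hi]
      exact mul_pos (hL.1 i) (hterm i hi)

end Matroid

/-! ### The Alexandrov–Fenchel inequality for matroids. -/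

namespace Matroid

open MvPolynomial

variable {α : Type*} [Fintype α]

theorem mixedDeriv_perm (M : Matroid α) {L L' : List (α → ℝ)} (h : L.Perm L') :
    M.mixedDeriv L = M.mixedDeriv L' := by
  have key : ∀ f : MvPolynomial α ℝ, listDeriv L f = listDeriv L' f := fun f => by
    induction h with
    | nil => rfl
    | cons v _ ih => rw [listDeriv_cons, listDeriv_cons, ih]
    | swap v w L => simp only [listDeriv_cons, dirDeriv_comm v w]
    | trans _ _ ih ih' => exact ih.trans ih'
  simp only [mixedDeriv, key]

variable [DecidableEq α]

theorem mixedDeriv_cons_eq_sum (M : Matroid α) (x : α → ℝ) (L : List (α → ℝ)) :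
    M.mixedDeriv (x :: L) = ∑ i, M.mixedDeriv (Pi.single i 1 :: L) * x i := by
  unfold mixedDeriv
  rw [listDeriv_cons, dirDeriv_apply, map_sum]
  refine Finset.sum_congr rfl fun i _ => ?_
  rw [listDeriv_cons, dirDeriv_single, smul_eval, mul_comm]

open Classical in
theorem mixedDeriv_single_cons (M : Matroid α) (i : α) (L : List (α → ℝ)) :
    M.mixedDeriv (Pi.single i 1 :: L) =
      if M.IsNonloop i then (M ／ {i}).mixedDeriv L else 0 := by
  rw [mixedDeriv_cons, Finset.sum_eq_single i]
  · simp
  · intro j _ hj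
    simp [hj]
  · simp

/-- The matrix of the bilinear form `(x, y) ↦ D_x D_y D_L g_M (0)`. -/
noncomputable def mixedMatrix (M : Matroid α) (L : List (α → ℝ)) : Matrix α α ℝ :=
  Matrix.of fun i j => M.mixedDeriv (Pi.single i 1 :: Pi.single j 1 :: L)

theorem mixedMatrix_isSymm (M : Matroid α) (L : List (α → ℝ)) : (M.mixedMatrix L).IsSymm :=
  Matrix.IsSymm.ext fun _ _ => M.mixedDeriv_perm (List.Perm.swap _ _ _)

theorem mixedMatrix_mulVec (M : Matroid α) (L : List (α → ℝ)) (y : α → ℝ) (i : α) :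
    (M.mixedMatrix L).mulVec y i = M.mixedDeriv (Pi.single i 1 :: y :: L) := by
  rw [M.mixedDeriv_perm (List.Perm.swap _ _ _), mixedDeriv_cons_eq_sum]
  exact Finset.sum_congr rfl fun j _ => congrArg (· * y j)
    (M.mixedDeriv_perm (List.Perm.swap _ _ _))

theorem dotProduct_mixedMatrix_mulVec (M : Matroid α) (L : List (α → ℝ)) (x y : α → ℝ) :
    x ⬝ᵥ (M.mixedMatrix L).mulVec y = M.mixedDeriv (x :: y :: L) := by
  rw [M.mixedDeriv_cons_eq_sum x, dotProduct]
  exact Finset.sum_congr rfl fun i _ => by rw [mixedMatrix_mulVec, mul_comm]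

open Classical in
theorem mixedMatrix_apply (M : Matroid α) (L : List (α → ℝ)) (i j : α) :
    M.mixedMatrix L i j =
      if M.IsNonloop i ∧ M.IsNonloop j ∧ M.closure {i} ≠ M.closure {j} then
        (M ／ {i} ／ {j}).mixedDeriv L else 0 := by
  rw [mixedMatrix, Matrix.of_apply, mixedDeriv_single_cons]
  by_cases hi : M.IsNonloop i
  · rw [if_pos hi, mixedDeriv_single_cons]
    simp only [contract_singleton_isNonloop_iff, hi, true_and]
  · simp [hi]

theorem mixedMatrix_pos {M : Matroid α} {L : List (α → ℝ)} (hL : ∀ v ∈ L, ∀ i, 0 < v i)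
    (hd : M.eRank = (L.length + 2 : ℕ)) {i j : α} (hi : M.IsNonloop i) (hj : M.IsNonloop j)
    (hij : M.closure {i} ≠ M.closure {j}) : 0 < M.mixedMatrix L i j := by
  classical
  rw [mixedMatrix_apply, if_pos ⟨hi, hj, hij⟩]
  refine mixedDeriv_pos hL (IsNonloop.eRank_contract_singleton_eq ?_
    (hi.eRank_contract_singleton_eq hd))
  exact contract_singleton_isNonloop_iff.2 ⟨hj, hij⟩

theorem mixedMatrix_nonneg (M : Matroid α) {L : List (α → ℝ)} (hL : ∀ v ∈ L, ∀ i, 0 < v i)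
    (i j : α) : 0 ≤ M.mixedMatrix L i j := by
  classical
  rw [mixedMatrix_apply]
  split_ifs
  exacts [mixedDeriv_nonneg _ fun v hv i => (hL v hv i).le, le_rfl]

omit [DecidableEq α] in
-- Grouping indices by the value of `c` gives a sum of squares, one for each fibre.
theorem sum_sum_ite_eq_nonneg {β : Type*} [DecidableEq β] (c : α → β) (u : α → ℝ) :
    0 ≤ ∑ i, ∑ j, if c i = c j then u i * u j else 0 := by
  have h : ∀ i j, (if c i = c j then u i * u j else 0) =
      ∑ s ∈ Finset.univ.image c,
        (if c i = s then u i else 0) * (if c j = s then u j else 0) := fun i j => by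
    rw [Finset.sum_eq_single (c i)]
    · simp [eq_comm]
    · intro s _ hs
      simp [Ne.symm hs]
    · simp
  simp only [h]
  rw [Finset.sum_congr rfl fun i _ => Finset.sum_comm, Finset.sum_comm]
  refine Finset.sum_nonneg fun s _ => ?_
  rw [← Finset.sum_mul_sum]
  exact mul_self_nonneg _

open Classical in
/-- For a matroid of rank two, the Hessian of the basis generating polynomial is nonpositive on the
vectors whose coordinates at the nonloops sum to zero. -/
theorem dotProduct_mixedMatrix_nil_nonpos {M : Matroid α} (hd : M.eRank = (2 : ℕ)) {x : α → ℝ}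
    (hx : (fun i => if M.IsNonloop i then (1 : ℝ) else 0) ⬝ᵥ x = 0) :
    x ⬝ᵥ (M.mixedMatrix []).mulVec x ≤ 0 := by
  set u : α → ℝ := fun i => if M.IsNonloop i then x i else 0 with hu
  have hu0 : ∑ i, u i = 0 := by
    rw [← hx]
    exact Finset.sum_congr rfl fun i _ => by simp [hu]
  -- Two nonparallel nonloops contract to rank zero, where the basis polynomial is 1. The first term
  -- vanishes on the hyperplane; the second sums to squares over parallel classes.
  have hH : ∀ i j, x i * (M.mixedMatrix [] i j * x j) =
      u i * u j - if M.closure {i} = M.closure {j} then u i * u j else 0 := fun i j => by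
    rw [mixedMatrix_apply]
    by_cases hi : M.IsNonloop i
    swap
    · simp [hu, hi]
    by_cases hj : M.IsNonloop j
    swap
    · simp [hu, hj]
    by_cases hij : M.closure {i} = M.closure {j}
    · simp [hij]
    have h0 : (M ／ {i} ／ {j}).eRank = (0 : ℕ) := IsNonloop.eRank_contract_singleton_eq
      (contract_singleton_isNonloop_iff.2 ⟨hj, hij⟩) (hi.eRank_contract_singleton_eq hd)
    simp [hi, hj, hij, hu, mixedDeriv, basisGenPoly_of_eRank_zero (by simpa using h0)]
  have hsum : x ⬝ᵥ (M.mixedMatrix []).mulVec x = (∑ i, u i) * (∑ j, u j) -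
      ∑ i, ∑ j, if M.closure {i} = M.closure {j} then u i * u j else 0 := by
    rw [Finset.sum_mul_sum]
    simp only [dotProduct, Matrix.mulVec, Finset.mul_sum, hH, Finset.sum_sub_distrib]
  rw [hsum, hu0]
  linarith [sum_sum_ite_eq_nonneg (fun i => M.closure {i}) u]

/-- Connectivity of the support of `mixedMatrix`: any two nonloops are nonparallel, or have a
common nonparallel nonloop. -/
theorem mixedMatrix_connected {M : Matroid α} {L : List (α → ℝ)} (hL : ∀ v ∈ L, ∀ i, 0 < v i)
    (hd : M.eRank = (L.length + 2 : ℕ)) {i j : α} (hi : M.IsNonloop i) (hj : M.IsNonloop j) :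
    M.mixedMatrix L i j ≠ 0 ∨ ∃ k, M.mixedMatrix L i k ≠ 0 ∧ M.mixedMatrix L k j ≠ 0 := by
  by_cases hij : M.closure {i} = M.closure {j}
  · obtain ⟨k, hk, hki⟩ := exists_isNonloop_closure_ne hd i
    exact Or.inr ⟨k, (mixedMatrix_pos hL hd hi hk hki.symm).ne',
      (mixedMatrix_pos hL hd hk hj (hij ▸ hki)).ne'⟩
  · exact Or.inl (mixedMatrix_pos hL hd hi hj hij).ne'

omit [DecidableEq α] in
/-- The Alexandrov–Fenchel inequality for mixed derivatives of basis generating polynomials. -/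
theorem mixedDeriv_mul_le_sq {M : Matroid α} {L : List (α → ℝ)} (hL : ∀ v ∈ L, ∀ i, 0 < v i)
    (hd : M.eRank = (L.length + 2 : ℕ)) {w : α → ℝ} (hw : ∀ i, 0 < w i) (x : α → ℝ) :
    M.mixedDeriv (x :: x :: L) * M.mixedDeriv (w :: w :: L) ≤ M.mixedDeriv (x :: w :: L) ^ 2 := by
  classical
  induction L generalizing M w x with
  | nil =>
    have hpos : 0 < M.mixedDeriv [w, w] :=
      mixedDeriv_pos (by simpa using hw) (by simpa using hd)
    simp only [← dotProduct_mixedMatrix_mulVec] at hpos ⊢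
    exact Matrix.mul_le_sq_of_nonpos_on_hyperplane (M.mixedMatrix_isSymm [])
      (fun y hy => dotProduct_mixedMatrix_nil_nonpos hd hy) hpos x
  | cons v L ih =>
    have hpos : 0 < M.mixedDeriv (w :: w :: v :: L) :=
      mixedDeriv_pos (by simpa [hw] using hL) hd
    have hL' := hL
    simp only [List.mem_cons, forall_eq_or_imp] at hL'
    have hrow : ∀ y i, (M.mixedMatrix (v :: L)).mulVec y i =
        if M.IsNonloop i then (M ／ {i}).mixedDeriv (y :: v :: L) else 0 := fun y i => by
      rw [mixedMatrix_mulVec, mixedDeriv_single_cons]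
    simp only [← dotProduct_mixedMatrix_mulVec] at hpos ⊢
    -- The hyperplane is taken orthogonal to `H *ᵥ v`, not `H *ᵥ w`: expanding along `v` is what
    -- produces the weights of the required bound.
    refine Matrix.mul_le_sq_of_nonpos_on_hyperplane (M.mixedMatrix_isSymm _)
      (l := (M.mixedMatrix (v :: L)).mulVec v) (fun y hy => ?_) hpos x
    refine Matrix.dotProduct_mulVec_nonpos_of_le_sum (M.mixedMatrix_isSymm _)
      (M.mixedMatrix_nonneg hL) hL'.1 (fun i j hi hj => ?_) (fun y => ?_) hy
    · rw [hrow] at hi hj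
      exact mixedMatrix_connected hL hd (ite_ne_right_iff.1 hi).1 (ite_ne_right_iff.1 hj).1
    -- Moving `v` to the front splits the form into contractions, each bounded by induction with `v`
    -- as the positive direction.
    · have hperm : (y :: y :: v :: L).Perm (v :: y :: y :: L) :=
        (List.Perm.cons y (List.Perm.swap _ _ _)).trans (List.Perm.swap _ _ _)
      rw [dotProduct_mixedMatrix_mulVec, M.mixedDeriv_perm hperm, mixedDeriv_cons]
      refine Finset.sum_le_sum fun i _ => mul_le_mul_of_nonneg_left ?_ (hL'.1 i).le
      rw [hrow, hrow]
      split_ifs with hi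
      · have hdi := hi.eRank_contract_singleton_eq (d := L.length + 2) hd
        rw [le_div_iff₀ (mixedDeriv_pos (by simpa [hL'.1] using hL'.2) hdi)]
        exact ih hL'.2 hdi hL'.1 y
      · simp

omit [DecidableEq α] in
-- Adding `ε` to all coordinates of the directions in `L` makes them positive; then `ε` tends to 0
-- from the right.
theorem mixedDeriv_mul_le_sq_of_nonneg {M : Matroid α} {L : List (α → ℝ)}
    (hL : ∀ v ∈ L, ∀ i, 0 ≤ v i) (hd : M.eRank = (L.length + 2 : ℕ)) {w : α → ℝ}
    (hw : ∀ i, 0 < w i) (x : α → ℝ) :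
    M.mixedDeriv (x :: x :: L) * M.mixedDeriv (w :: w :: L) ≤ M.mixedDeriv (x :: w :: L) ^ 2 := by
  let L' : ℝ → List (α → ℝ) := fun ε => L.map fun v => v + ε • fun _ => 1
  have hL0 : L' 0 = L := by simp [L']
  have hcont : ∀ a b : α → ℝ, Filter.Tendsto (fun ε => M.mixedDeriv (a :: b :: L' ε))
      (nhdsWithin 0 (Set.Ioi 0)) (nhds (M.mixedDeriv (a :: b :: L))) := fun a b => by
    have h := continuous_eval_listDeriv_perturb (fun _ => 1) L
      (dirDeriv b (dirDeriv a M.basisGenPoly))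
    have h2 : ∀ ε, M.mixedDeriv (a :: b :: L' ε) =
        eval 0 (listDeriv (L' ε) (dirDeriv b (dirDeriv a M.basisGenPoly))) := fun ε => by
      rw [mixedDeriv, listDeriv_cons, listDeriv_cons, dirDeriv_listDeriv, dirDeriv_listDeriv,
        dirDeriv_comm]
    simp only [← hL0, h2]
    exact h.continuousAt.tendsto.mono_left nhdsWithin_le_nhds
  refine le_of_tendsto_of_tendsto ((hcont x x).mul (hcont w w)) ((hcont x w).pow 2) ?_
  filter_upwards [self_mem_nhdsWithin] with ε hε
  refine mixedDeriv_mul_le_sq (fun v hv i => ?_) (by simpa [L'] using hd) hw x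
  obtain ⟨u, hu, rfl⟩ := List.mem_map.1 hv
  have := hL u hu i
  have : 0 < ε := hε
  simp only [Pi.add_apply, Pi.smul_apply, smul_eq_mul, mul_one]
  linarith

end Matroid

/-! ### From mixed derivatives to log-concavity. -/

namespace Matroid

open MvPolynomial

variable {α : Type*} [Fintype α]

/-- The Hessian criterion for log-concavity holds for all nonnegative directional derivatives of
the basis generating polynomial. -/
theorem eval_mul_eval_dirDeriv_le_sq {M : Matroid α} {L : List (α → ℝ)}
    (hL : ∀ v ∈ L, ∀ i, 0 ≤ v i) {e : ℕ} (hd : M.eRank = (L.length + e : ℕ)) {z : α → ℝ}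
    (hz : z ∈ positiveOrthant α) (x : α → ℝ) :
    eval z (listDeriv L M.basisGenPoly) *
        eval z (dirDeriv x (dirDeriv x (listDeriv L M.basisGenPoly))) ≤
      eval z (dirDeriv x (listDeriv L M.basisGenPoly)) ^ 2 := by
  set f := listDeriv L M.basisGenPoly with hf
  have hfhom : f.IsHomogeneous e := by
    simpa using (isHomogeneous_basisGenPoly hd).listDeriv L
  have hfpos : 0 ≤ eval z f := eval_nonneg_of_coeff_nonneg
    (listDeriv_coeff_nonneg M.coeff_basisGenPoly_nonneg hL) fun i => (hz i).le
  rcases lt_or_ge e 2 with he | he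
  · have h0 : dirDeriv x (dirDeriv x f) = 0 := by
      apply dirDeriv_eq_zero_of_isHomogeneous_zero
      simpa [show e - 1 = 0 by omega] using hfhom.dirDeriv x
    rw [h0, map_zero, mul_zero]
    positivity
  obtain ⟨m, rfl⟩ := Nat.exists_eq_add_of_le' he
  have hd1 : (dirDeriv x f).IsHomogeneous (m + 1) := hfhom.dirDeriv x
  have hd2 : (dirDeriv x (dirDeriv x f)).IsHomogeneous m := hd1.dirDeriv x
  -- With `m` copies of `z` added to `L`, the three mixed derivatives become multiples of `r`, `q`
  -- and `p` below by `m!`, `(m+1)!` and `(m+2)!`.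
  have key := mixedDeriv_mul_le_sq_of_nonneg (M := M) (L := List.replicate m z ++ L)
    (fun v hv i => by
      rcases List.mem_append.1 hv with hv | hv
      · rw [List.eq_of_mem_replicate hv]; exact (hz i).le
      · exact hL v hv i)
    (by rw [hd]; simp; ring) hz x
  have e1 : M.mixedDeriv (x :: x :: (List.replicate m z ++ L)) =
      m.factorial * eval z (dirDeriv x (dirDeriv x f)) := by
    rw [← hd2.eval_listDeriv_replicate z, mixedDeriv, listDeriv_cons, listDeriv_cons,
      listDeriv_append, dirDeriv_listDeriv, dirDeriv_listDeriv]
  have e2 : M.mixedDeriv (x :: z :: (List.replicate m z ++ L)) =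
      (m + 1).factorial * eval z (dirDeriv x f) := by
    rw [← hd1.eval_listDeriv_replicate z, mixedDeriv, ← List.cons_append, ← List.replicate_succ,
      listDeriv_cons, listDeriv_append, dirDeriv_listDeriv]
  have e3 : M.mixedDeriv (z :: z :: (List.replicate m z ++ L)) =
      (m + 2).factorial * eval z f := by
    rw [← hfhom.eval_listDeriv_replicate z, mixedDeriv, ← List.cons_append, ← List.cons_append,
      ← List.replicate_succ, ← List.replicate_succ, listDeriv_append]
  rw [e1, e2, e3, Nat.factorial_succ (m + 1), Nat.factorial_succ m] at key
  push_cast at key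
  set p := eval z f
  set q := eval z (dirDeriv x f)
  set r := eval z (dirDeriv x (dirDeriv x f))
  have hc : 0 < ((m : ℝ) + 1) * (m.factorial : ℝ) ^ 2 := by positivity
  -- Cancelling factorials leaves a ratio `(m+1)/(m+2) < 1`, so this is stronger than the required
  -- inequality.
  have key2 : ((m : ℝ) + 2) * (p * r) ≤ ((m : ℝ) + 1) * q ^ 2 := by
    refine le_of_mul_le_mul_left ?_ hc
    nlinarith
  have hm : (0 : ℝ) < (m : ℝ) + 2 := by positivity
  refine le_of_mul_le_mul_left (key2.trans ?_) hm
  nlinarith [sq_nonneg q]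

end Matroid

theorem mainTheorem3 {α : Type*} [Fintype α] (M : Matroid α) :
    M.basisGenPoly.IsCompletelyLogConcave := by
  intro k V hV
  rw [MvPolynomial.matrixDeriv_eq_listDeriv]
  set L : List (α → ℝ) := List.ofFn fun j i => V i j with hLdef
  have hL : ∀ v ∈ L, ∀ i, 0 ≤ v i := fun v hv i => by
    obtain ⟨j, rfl⟩ := List.mem_ofFn.1 hv
    exact hV i j
  have hcoeff := MvPolynomial.listDeriv_coeff_nonneg M.coeff_basisGenPoly_nonneg hL
  refine ⟨fun z hz => MvPolynomial.eval_nonneg_of_coeff_nonneg hcoeff fun i => (hz i).le, ?_⟩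
  by_cases h0 : MvPolynomial.listDeriv L M.basisGenPoly = 0
  · exact Or.inl h0
  have hpos : ∀ z ∈ positiveOrthant α,
      0 < MvPolynomial.eval z (MvPolynomial.listDeriv L M.basisGenPoly) :=
    fun z hz => MvPolynomial.eval_pos_of_coeff_nonneg hcoeff h0 hz
  refine Or.inr ⟨hpos, MvPolynomial.concaveOn_log_eval hpos fun z hz x => ?_⟩
  obtain ⟨d, hd⟩ := ENat.ne_top_iff_exists.1 (M.eRank_ne_top_iff.2 inferInstance)
  -- A nonzero derivative has order at most the rank, so `d - L.length` is a genuine difference.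
  have hle : L.length ≤ d := by
    by_contra! hlt
    exact h0 (MvPolynomial.listDeriv_eq_zero_of_lt (Matroid.isHomogeneous_basisGenPoly hd.symm) L hlt)
  exact Matroid.eval_mul_eval_dirDeriv_le_sq hL (e := d - L.length)
    (by rw [Nat.add_sub_cancel' hle, hd]) hz x
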